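/- **Game.** $N$ agents play in rounds $t=0,1,2,\dots$. Agent $i$ has a saving $x_{i,t}$ in an interval $Z_i\subseteq\mathbb R$, a message space $\mathbb R^{d_i}$, and a policy $\pi_i(\cdot,\cdot\,;w_i)$ with parameter $w_i\in W_i\subseteq\mathbb R^{n_i}$. In round $t$ it gives out $b_{i,t}\in\mathbb R$ and selects a privacy level $p_{i,t}\in\mathbb R$ by $$(b_{i,t},p_{i,t})=\pi_i(x_{i,t},m_{-i,t-1};w_i),\qquad m_{i,t}=f_i(x_{i,t},b_{i,t},p_{i,t},\xi_{i,t}),\qquad x_{i,t+1}=x_{i,t}-b_{i,t},$$ where $m_{-i,t-1}$ are the messages sent by the other agents in the previous round and the $\xi_{i,t}$ are random variables with an arbitrary given joint law (the randomization of the message functions $f_i$). The initial state $s=(x_0,m_{-1})$ is given. With $\alpha,\beta\in\mathbb R$ the reward is $$r_i(x_t,a_t)=\sum_{j}(1-p_{j,t})b_{j,t}+\alpha x_{i,t}+\beta p_{i,t},\qquad a_t=(b_{j,t},p_{j,t})_j,$$ and $V^i_s(w)=\mathbb E\big[\sum_t\gamma^t r_i(x_t,a_t)\big]$ with $\gamma\in[0,1)$.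 Each agent may be subject to finitely many constraints $g_{i,l}(x_{i,t},b_{i,t},p_{i,t})\le 0$ (for example $0\le p_{i,t}\le 1$). A profile $w$ is feasible from $s$ if $w_i\in W_i$ for all $i$ and always (in every round and for every outcome of the noise) $x_{i,t}\in Z_i$ and all constraints hold. Returns are assumed well defined: for every $s$, every profile feasible from $s$ and every agent $j$, the discounted sums of $(1-p_{j,t})b_{j,t}$ and of $\alpha x_{j,t}+\beta p_{j,t}$ converge absolutely in mean. **Zero message gradient.** Assume that no gradient flows between messages and message functions: for all $i\ne j$, all $x_j\in Z_j$, $w_j\in W_j$, all messages $m_l$ ($l\ne i,j$) and all noise values $\xi$, the map $$(x_i,b_i,p_i)\mapsto \pi_j\big(x_j,\,(m_l)_{l\neq i,j},\,m_i=f_i(x_i,b_i,p_i,\xi);\,w_j\big)$$ has gradient zero on $Z_i\times\mathbb R^2$. **Claim 1.** Put $$J(x_t,a_t)=\sum_{j}\big((1-p_{j,t})b_{j,t}+\alpha x_{j,t}+\beta p_{j,t}\big),\qquad \Theta_k(x_t,a_t)=-\sum_{j\ne k}(\alpha x_{j,t}+\beta p_{j,t}).$$ Then $r_k=J+\Theta_k$,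 where $\Theta_k$ does not involve the saving and action of agent $k$, and the gradient of $\Theta_k$ in the data $(x_k,b_k,p_k)$ that agent $k$ can pass on through its message is zero. The game is a Markov potential game, with potential generated by $J$: with $\Phi_s(w)=\mathbb E\big[\sum_t\gamma^tJ(x_t,a_t)\big]$, $$\Phi_s(w_i,w_{-i})-\Phi_s(w_i',w_{-i})=V^i_s(w_i,w_{-i})-V^i_s(w_i',w_{-i})$$ for every state $s$, every agent $i$ and all profiles $(w_i,w_{-i})$, $(w'_i,w_{-i})$ feasible from $s$. **Claim 2.** Write $Z=\prod_iZ_i$, $W=\prod_iW_i$. Suppose in addition: 1. all $Z_i$ and $W_i$ are nonempty, closed and convex; 2. for all received messages, each reward is twice continuously differentiable as a function of $(x,w)\in Z\times W$ (with actions given by the policies); 3. for all received messages, the transition and the constraints are continuously differentiable as functions of $(x,w)\in Z\times W$, and the constraints satisfy the Mangasarian–Fromovitz condition on $Z\times W$: at each $z\in Z\times W$ where the constraints hold there is $z'\in Z\times W$ such that the derivative in direction $z'-z$ of every active constraint is negative; 4. for the initial state $s$ there is a scalar $B$ such that for each agent $k$ the level sets $$L_{k,t}=\{(w,x_t,a_t):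 w \text{ feasible from } s,\ (x_t,a_t)\text{ a possible round-}t\text{ outcome under } w,\ r_k(x_t,a_t)\ge B\},\quad t\ge0,$$ are nonempty along play (some feasible profile stays in $L_{k,t}$ for all $t$ and all outcomes of the noise) and bounded (by one bound for all $t$). Then the game started at $s$ has a Nash equilibrium: a feasible profile $w^*$ such that $V^i_s(w_i,w^*_{-i})\le V^i_s(w^*)$ for every agent $i$ and every $w_i$ with $(w_i,w^*_{-i})$ feasible from $s$. -/

import Mathlib

open MeasureTheory Set

noncomputable section

/-- The `N`-player multiple round sums game with parametric closed-loop policies.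

In round `t` agent `i` has saving `x i`, observes the messages the other agents sent in the
previous round, gives out `b i` and picks a privacy level `p i`, where `(b i, p i)` is the value of
its policy; it then emits a message produced by its (possibly randomized) sender from
`(x i, b i, p i)`.  Randomization is written through an exogenous noise variable `noise i t`, whose
joint law is arbitrary. -/
structure MultiRoundSums (N : ℕ) (Ω Ξ : Type*) [MeasurableSpace Ω] [MeasurableSpace Ξ] where
  /-- weight of the saving in the reward -/
  α : ℝ
  /-- weight of the privacy level in the reward -/
  β : ℝ
  /-- discount factor -/
  γ : ℝ
  γ_nonneg : 0 ≤ γ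
  γ_lt_one : γ < 1
  /-- law of the randomness used by the senders -/
  P : Measure Ω
  isProbabilityMeasure_P : IsProbabilityMeasure P
  /-- dimension of the message space of each agent -/
  msgDim : Fin N → ℕ
  /-- dimension of the policy parameter of each agent -/
  parDim : Fin N → ℕ
  /-- savings allowed to each agent (an interval) -/
  stateSet : Fin N → Set ℝ
  convex_stateSet : ∀ i, Convex ℝ (stateSet i)
  /-- policy parameters allowed to each agent -/
  paramSet : (i : Fin N) → Set (EuclideanSpace ℝ (Fin (parDim i)))
  /-- number of inequality constraints on each agent -/
  numCon : Fin N → ℕ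
  /-- constraints `con i (x i) (b i, p i) l ≤ 0` on each agent -/
  con : (i : Fin N) → ℝ → ℝ × ℝ → Fin (numCon i) → ℝ
  /-- `policy i (x i) m₋ᵢ (w i) = (b i, p i)` -/
  policy : (i : Fin N) → ℝ →
    ((j : {j : Fin N // j ≠ i}) → EuclideanSpace ℝ (Fin (msgDim j))) →
    EuclideanSpace ℝ (Fin (parDim i)) → ℝ × ℝ
  /-- message function: `sender i (x i, b i, p i) ξ` is the message of agent `i` under noise `ξ` -/
  sender : (i : Fin N) → ℝ × ℝ × ℝ → Ξ → EuclideanSpace ℝ (Fin (msgDim i))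
  measurable_sender : ∀ i, Measurable (Function.uncurry (sender i))
  /-- noise of agent `i` in round `t` -/
  noise : Fin N → ℕ → Ω → Ξ
  measurable_noise : ∀ i t, Measurable (noise i t)

namespace MultiRoundSums

variable {N : ℕ} {Ω Ξ : Type*} [MeasurableSpace Ω] [MeasurableSpace Ξ]

/-- One message per agent. -/
abbrev Messages (G : MultiRoundSums N Ω Ξ) : Type :=
  (i : Fin N) → EuclideanSpace ℝ (Fin (G.msgDim i))

/-- Profiles of policy parameters (equivalently, of policies in the parametric classes). -/
abbrev Profile (G : MultiRoundSums N Ω Ξ) : Type :=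
  (i : Fin N) → EuclideanSpace ℝ (Fin (G.parDim i))

/-- What the agents act on: the savings of this round and the messages of the previous round. -/
abbrev State (G : MultiRoundSums N Ω Ξ) : Type := (Fin N → ℝ) × G.Messages

/-- Joint actions `a i = (b i, p i)`. -/
abbrev Action (N : ℕ) : Type := Fin N → ℝ × ℝ

/-- The messages `m₋ᵢ` that agent `i` receives. -/
def received (G : MultiRoundSums N Ω Ξ) (i : Fin N) (m : G.Messages) :
    (j : {j : Fin N // j ≠ i}) → EuclideanSpace ℝ (Fin (G.msgDim j)) :=
  fun j => m j

/-- Joint action of the profile `w` at savings `x` after messages `m`. -/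
def act (G : MultiRoundSums N Ω Ξ) (x : Fin N → ℝ) (m : G.Messages) (w : G.Profile) : Action N :=
  fun i => G.policy i (x i) (G.received i m) (w i)

/-- Team term `(1 - p j) * b j` contributed by agent `j`. -/
def giveTerm (_G : MultiRoundSums N Ω Ξ) (j : Fin N) (a : Action N) : ℝ :=
  (1 - (a j).2) * (a j).1

/-- Individual term `α * x j + β * p j` of agent `j`. -/
def ownTerm (G : MultiRoundSums N Ω Ξ) (j : Fin N) (x : Fin N → ℝ) (a : Action N) : ℝ :=
  G.α * x j + G.β * (a j).2

/-- Reward of agent `i` in one round. -/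
def reward (G : MultiRoundSums N Ω Ξ) (i : Fin N) (x : Fin N → ℝ) (a : Action N) : ℝ :=
  (∑ j, (1 - (a j).2) * (a j).1) + G.α * x i + G.β * (a i).2

/-- The function `J`. -/
def J (G : MultiRoundSums N Ω Ξ) (x : Fin N → ℝ) (a : Action N) : ℝ :=
  ∑ j, ((1 - (a j).2) * (a j).1 + G.α * x j + G.β * (a j).2)

/-- The term `Θ k`, which involves savings and actions of the agents other than `k` only. -/
def Θ (G : MultiRoundSums N Ω Ξ) (k : Fin N) (x : Fin N → ℝ) (a : Action N) : ℝ :=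
  -∑ j ∈ Finset.univ.erase k, (G.α * x j + G.β * (a j).2)

/-- Savings `x_t` and messages `m_{t-1}` under profile `w`, from the initial state `s`. -/
def traj (G : MultiRoundSums N Ω Ξ) (s : G.State) (w : G.Profile) (ω : Ω) : ℕ → G.State
  | 0 => s
  | t + 1 =>
    let x := (traj G s w ω t).1
    let a := G.act x (traj G s w ω t).2 w
    (fun i => x i - (a i).1, fun i => G.sender i (x i, (a i).1, (a i).2) (G.noise i t ω))

/-- Savings in round `t`. -/
def saving (G : MultiRoundSums N Ω Ξ) (s : G.State) (w : G.Profile) (ω : Ω) (t : ℕ) : Fin N → ℝ :=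
  (G.traj s w ω t).1

/-- Actions in round `t`. -/
def action (G : MultiRoundSums N Ω Ξ) (s : G.State) (w : G.Profile) (ω : Ω) (t : ℕ) : Action N :=
  G.act (G.traj s w ω t).1 (G.traj s w ω t).2 w

/-- `w` is an allowed profile whose play from `s` respects state sets and constraints in every
round. -/
def Feasible (G : MultiRoundSums N Ω Ξ) (s : G.State) (w : G.Profile) : Prop :=
  (∀ i, w i ∈ G.paramSet i) ∧
  ∀ ω t i, G.saving s w ω t i ∈ G.stateSet i ∧
    ∀ l, G.con i (G.saving s w ω t i) (G.action s w ω t i) l ≤ 0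

/-- Expected discounted sum of a one-round quantity. -/
def expectedReturn (G : MultiRoundSums N Ω Ξ) (r : (Fin N → ℝ) → Action N → ℝ)
    (s : G.State) (w : G.Profile) : ℝ :=
  ∫ ω, ∑' t : ℕ, G.γ ^ t * r (G.saving s w ω t) (G.action s w ω t) ∂G.P

/-- The value `V_s^i(w)` of agent `i`. -/
def value (G : MultiRoundSums N Ω Ξ) (i : Fin N) (s : G.State) (w : G.Profile) : ℝ :=
  G.expectedReturn (G.reward i) s w

/-- The potential `Φ_s(w)` generated by `J`. -/
def potentialValue (G : MultiRoundSums N Ω Ξ) (s : G.State) (w : G.Profile) : ℝ :=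
  G.expectedReturn G.J s w

/-- The discounted sums of the team and individual terms converge absolutely in mean. -/
def ReturnsConverge (G : MultiRoundSums N Ω Ξ) (s : G.State) (w : G.Profile) : Prop :=
  ∀ j,
    (∀ t, Integrable (fun ω => G.giveTerm j (G.action s w ω t)) G.P) ∧
    (∀ t, Integrable (fun ω => G.ownTerm j (G.saving s w ω t) (G.action s w ω t)) G.P) ∧
    (Summable fun t : ℕ => G.γ ^ t * ∫ ω, |G.giveTerm j (G.action s w ω t)| ∂G.P) ∧
    (Summable fun t : ℕ =>
      G.γ ^ t * ∫ ω, |G.ownTerm j (G.saving s w ω t) (G.action s w ω t)| ∂G.P)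

/-- `Φ` is a potential: at every state, under every unilateral deviation between feasible
profiles, the change of `Φ` is the change of the deviator's value. -/
def IsMarkovPotential (G : MultiRoundSums N Ω Ξ) (Φ : G.State → G.Profile → ℝ) : Prop :=
  ∀ (s : G.State) (i : Fin N) (w w' : G.Profile), (∀ j, j ≠ i → w j = w' j) →
    G.Feasible s w → G.Feasible s w' →
    Φ s w - Φ s w' = G.value i s w - G.value i s w'

/-- Markov potential game. -/
def IsMarkovPotentialGame (G : MultiRoundSums N Ω Ξ) : Prop :=
  ∃ Φ : G.State → G.Profile → ℝ, G.IsMarkovPotential Φ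

/-- Nash equilibrium of the game started at `s`. -/
def IsNash (G : MultiRoundSums N Ω Ξ) (s : G.State) (w : G.Profile) : Prop :=
  G.Feasible s w ∧
  ∀ (i : Fin N) (v : EuclideanSpace ℝ (Fin (G.parDim i))),
    G.Feasible s (Function.update w i v) → G.value i s (Function.update w i v) ≤ G.value i s w

/-- No gradient flows through messages: for agents `i ≠ j`, the decision of `j`, seen as a function
of the data `(x i, b i, p i)` that the message function of `i` encodes into the message sent to
`j`, has gradient zero.  It holds for instance if every message function has zero gradient, and also
if every policy has zero gradient in the received messages. -/
def ZeroMessageGradient (G : MultiRoundSums N Ω Ξ) : Prop :=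
  ∀ i j : Fin N, i ≠ j → ∀ x ∈ G.stateSet j, ∀ w ∈ G.paramSet j, ∀ (m : G.Messages) (ξ : Ξ),
    ∀ y ∈ G.stateSet i ×ˢ (univ : Set (ℝ × ℝ)),
      HasFDerivWithinAt
        (fun y : ℝ × ℝ × ℝ =>
          G.policy j x (G.received j (Function.update m i (G.sender i y ξ))) w)
        (0 : ℝ × ℝ × ℝ →L[ℝ] ℝ × ℝ) (G.stateSet i ×ˢ univ) y

/-- The decomposition `r k = J + Θ k`, with `Θ k` independent of the saving and action of agent `k`,
and the gradient of `Θ k` with respect to what agent `k` can feed into it, through its message, is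
zero. -/
def RewardDecomposition (G : MultiRoundSums N Ω Ξ) : Prop :=
  ∀ k : Fin N,
    (∀ x a, G.reward k x a = G.J x a + G.Θ k x a) ∧
    (∀ x x' a a', (∀ j, j ≠ k → x j = x' j ∧ a j = a' j) → G.Θ k x a = G.Θ k x' a') ∧
    ∀ x : Fin N → ℝ, (∀ j, x j ∈ G.stateSet j) → ∀ w : G.Profile, (∀ j, w j ∈ G.paramSet j) →
      ∀ (m : G.Messages) (ξ : Ξ), ∀ y ∈ G.stateSet k ×ˢ (univ : Set (ℝ × ℝ)),
        HasFDerivWithinAt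
          (fun y : ℝ × ℝ × ℝ =>
            G.Θ k (Function.update x k y.1)
              (G.act (Function.update x k y.1) (Function.update m k (G.sender k y ξ)) w))
          (0 : ℝ × ℝ × ℝ →L[ℝ] ℝ) (G.stateSet k ×ˢ univ) y

/-- The set of all allowed savings and parameters, `Z × W`. -/
def domain (G : MultiRoundSums N Ω Ξ) : Set ((Fin N → ℝ) × G.Profile) :=
  {z | (∀ i, z.1 i ∈ G.stateSet i) ∧ ∀ i, z.2 i ∈ G.paramSet i}

/-- State and parameter sets are nonempty, closed and convex. -/
def ConvexSets (G : MultiRoundSums N Ω Ξ) : Prop :=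
  ∀ i, ((G.stateSet i).Nonempty ∧ IsClosed (G.stateSet i) ∧ Convex ℝ (G.stateSet i)) ∧
    ((G.paramSet i).Nonempty ∧ IsClosed (G.paramSet i) ∧ Convex ℝ (G.paramSet i))

/-- The rewards, as functions of savings and parameters, are twice continuously differentiable. -/
def SmoothRewards (G : MultiRoundSums N Ω Ξ) : Prop :=
  ∀ (m : G.Messages) (k : Fin N),
    ContDiffOn ℝ 2 (fun z : (Fin N → ℝ) × G.Profile => G.reward k z.1 (G.act z.1 m z.2)) G.domain

/-- Constraint `l` on agent `i`, as a function of savings and parameters. -/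
def conOn (G : MultiRoundSums N Ω Ξ) (m : G.Messages) (i : Fin N) (l : Fin (G.numCon i))
    (z : (Fin N → ℝ) × G.Profile) : ℝ :=
  G.con i (z.1 i) (G.act z.1 m z.2 i) l

/-- Mangasarian–Fromovitz condition for the constraints on the convex set `Z × W`: at each point
where the constraints hold, one direction pointing into the set is a strict descent direction for all
active constraints. -/
def MangasarianFromovitz (G : MultiRoundSums N Ω Ξ) : Prop :=
  ∀ (m : G.Messages), ∀ z ∈ G.domain, (∀ i l, G.conOn m i l z ≤ 0) →
    ∃ z' ∈ G.domain, ∀ i l, G.conOn m i l z = 0 →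
      fderivWithin ℝ (G.conOn m i l) G.domain z (z' - z) < 0

/-- Transition and constraints, as functions of savings and parameters, are continuously
differentiable, and the constraints are regular. -/
def RegularConstraints (G : MultiRoundSums N Ω Ξ) : Prop :=
  (∀ m : G.Messages, ContDiffOn ℝ 1
    (fun z : (Fin N → ℝ) × G.Profile => fun i => z.1 i - (G.act z.1 m z.2 i).1) G.domain) ∧
  (∀ (m : G.Messages) (i : Fin N) (l : Fin (G.numCon i)), ContDiffOn ℝ 1 (G.conOn m i l) G.domain) ∧
  G.MangasarianFromovitz

/-- Level set of the reward of agent `k` in round `t`: feasible parameters, together with savings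
and actions they can generate in that round, for which the reward is at least `B`. -/
def levelSet (G : MultiRoundSums N Ω Ξ) (s : G.State) (k : Fin N) (B : ℝ) (t : ℕ) :
    Set (G.Profile × (Fin N → ℝ) × Action N) :=
  {z | G.Feasible s z.1 ∧ (∃ ω, z.2 = (G.saving s z.1 ω t, G.action s z.1 ω t)) ∧
    B ≤ G.reward k z.2.1 z.2.2}

/-- For some `B` the level sets of each agent's reward are nonempty and bounded along play: some
feasible profile stays in them in all rounds, and one bound serves all rounds. -/
def BoundedLevelSets (G : MultiRoundSums N Ω Ξ) (s : G.State) : Prop :=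
  ∃ B : ℝ, ∀ k : Fin N,
    (∃ w : G.Profile, ∀ ω t, (w, G.saving s w ω t, G.action s w ω t) ∈ G.levelSet s k B t) ∧
    Bornology.IsBounded (⋃ t, G.levelSet s k B t)

end MultiRoundSums

end

/-! A function with zero gradient on a convex set is constant. Since `Z_i` is an interval, the
decision of agent `j` therefore depends on the message of agent `i` only through the noise, not
through the saving and action encoded in it (`ZeroMessageGradient.policy_congr`). Each message may
then be replaced by the one that a fixed datum produces under the same noise, which leaves feasible
play unchanged (`play_eq_ref`). In the replaced play the path of agent `j` is a function of `w j`
and the noise alone.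

Two consequences carry everything. The set of feasible profiles is a product
(`feasible_of_components`), and the value of agent `k` has the separated form `∑ j, A_j(w j) + C_k(w
k)` (`value_eq`). So `∑ j, A_j + ∑ j, C_j`, which is the discounted return of `J`, is a potential.

For an equilibrium, agent `k` only has to maximize `A_k + C_k`, whatever the others do. A maximizer
of the value of `k` over all feasible profiles exists: bounded level sets confine the search to a
compact set, and Fatou's lemma gives upper semicontinuity (`exists_isMaxOn_value`). The `k`-th
components of these maximizers together form an equilibrium. -/

open Filter Topology

namespace MultiRoundSums

variable {N : ℕ} {Ω Ξ : Type*} [MeasurableSpace Ω] [MeasurableSpace Ξ]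

/-! ### Messages convey nothing but noise. -/

/-- The decision of agent `j` does not depend on the data that agent `i` encodes into its message. -/
theorem ZeroMessageGradient.policy_update_eq {G : MultiRoundSums N Ω Ξ}
    (hgrad : G.ZeroMessageGradient) {i j : Fin N} (hij : i ≠ j) {x : ℝ} (hx : x ∈ G.stateSet j)
    {v : EuclideanSpace ℝ (Fin (G.parDim j))} (hv : v ∈ G.paramSet j) (m : G.Messages) (ξ : Ξ)
    {y y' : ℝ × ℝ × ℝ} (hy : y.1 ∈ G.stateSet i) (hy' : y'.1 ∈ G.stateSet i) :
    G.policy j x (G.received j (Function.update m i (G.sender i y ξ))) v =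
      G.policy j x (G.received j (Function.update m i (G.sender i y' ξ))) v := by
  have hconv : Convex ℝ (G.stateSet i ×ˢ (univ : Set (ℝ × ℝ))) :=
    (G.convex_stateSet i).prod convex_univ
  -- Mean value inequality with Lipschitz constant `0`.
  have h := hconv.norm_image_sub_le_of_norm_hasFDerivWithin_le (C := 0)
    (fun z hz => hgrad i j hij x hx v hv m ξ z hz) (by simp)
    (show y' ∈ _ from ⟨hy', mem_univ _⟩) (show y ∈ _ from ⟨hy, mem_univ _⟩)
  rw [zero_mul] at h
  exact sub_eq_zero.mp (norm_le_zero_iff.mp h)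

/-- Two message profiles sent under the same noise from allowed savings. -/
def SameNoise (G : MultiRoundSums N Ω Ξ) (m m' : G.Messages) : Prop :=
  m = m' ∨ ∀ i, ∃ (ξ : Ξ) (y y' : ℝ × ℝ × ℝ), y.1 ∈ G.stateSet i ∧ y'.1 ∈ G.stateSet i ∧
    m i = G.sender i y ξ ∧ m' i = G.sender i y' ξ

/-- The gradient hypothesis varies one sender at a time, so `m` is turned into `m'` one coordinate
after another, by induction on the set `S` of coordinates already exchanged. -/
theorem ZeroMessageGradient.policy_congr {G : MultiRoundSums N Ω Ξ}
    (hgrad : G.ZeroMessageGradient) {j : Fin N} {x : ℝ} (hx : x ∈ G.stateSet j)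
    {v : EuclideanSpace ℝ (Fin (G.parDim j))} (hv : v ∈ G.paramSet j) {m m' : G.Messages}
    (h : G.SameNoise m m') :
    G.policy j x (G.received j m) v = G.policy j x (G.received j m') v := by
  classical
  rcases h with rfl | h
  · rfl
  have key : ∀ S : Finset (Fin N),
      G.policy j x (G.received j (S.piecewise m' m)) v = G.policy j x (G.received j m) v := by
    intro S
    induction S using Finset.induction_on with
    | empty => simp
    | insert i S hi ih =>
      rw [← ih, Finset.piecewise_insert]
      -- An agent does not receive its own message, so exchanging coordinate `j` has no effect on
      -- agent `j`.
      by_cases hij : i = j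
      · subst hij
        congr 1
        funext l
        exact Function.update_of_ne l.2 _ _
      · obtain ⟨ξ, y, y', hy, hy', hm, hm'⟩ := h i
        have h1 := hgrad.policy_update_eq hij hx hv (S.piecewise m' m) ξ hy' hy
        rw [← hm, ← hm'] at h1
        rw [h1]
        congr 2
        rw [Function.update_eq_self_iff, Finset.piecewise_eq_of_notMem _ _ _ hi]
  have := key Finset.univ
  rw [Finset.piecewise_univ] at this
  exact this.symm

theorem act_congr {G : MultiRoundSums N Ω Ξ} (hgrad : G.ZeroMessageGradient) {x : Fin N → ℝ}
    (hx : ∀ i, x i ∈ G.stateSet i) {w : G.Profile} (hw : ∀ i, w i ∈ G.paramSet i)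
    {m m' : G.Messages} (h : G.SameNoise m m') : G.act x m w = G.act x m' w :=
  funext fun j => hgrad.policy_congr (hx j) (hw j) h

/-! ### Decoupled play against reference messages. -/

/-- Messages sent when all savings stay at their initial values and nothing is given out. -/
def refMessages (G : MultiRoundSums N Ω Ξ) (s : G.State) (ω : Ω) : ℕ → G.Messages
  | 0 => s.2
  | t + 1 => fun i => G.sender i (s.1 i, 0, 0) (G.noise i t ω)

/-- Savings when the agents receive the reference messages. -/
def refSaving (G : MultiRoundSums N Ω Ξ) (s : G.State) (w : G.Profile) (ω : Ω) : ℕ → Fin N → ℝ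
  | 0 => s.1
  | t + 1 => fun i => refSaving G s w ω t i -
      (G.act (refSaving G s w ω t) (G.refMessages s ω t) w i).1

/-- Actions when the agents receive the reference messages. -/
def refAction (G : MultiRoundSums N Ω Ξ) (s : G.State) (w : G.Profile) (ω : Ω) (t : ℕ) :
    Action N :=
  G.act (G.refSaving s w ω t) (G.refMessages s ω t) w

/-- The play against reference messages of an agent depends on its own parameter only. -/
theorem refSaving_congr (G : MultiRoundSums N Ω Ξ) (s : G.State) {w w' : G.Profile} {j : Fin N}
    (h : w j = w' j) (ω : Ω) (t : ℕ) : G.refSaving s w ω t j = G.refSaving s w' ω t j := by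
  induction t with
  | zero => rfl
  | succ t ih => simp only [refSaving, act, ih, h]

theorem refAction_congr (G : MultiRoundSums N Ω Ξ) (s : G.State) {w w' : G.Profile} {j : Fin N}
    (h : w j = w' j) (ω : Ω) (t : ℕ) : G.refAction s w ω t j = G.refAction s w' ω t j := by
  simp only [refAction, act, h, G.refSaving_congr s h]

/-- The messages of the two plays differ only in the encoded data, which the policies ignore as long
as savings are allowed. The hypothesis is a disjunction because it is enough that one of the plays
stays in the state sets: the induction carries this over to the other. Both cases are needed to test
feasibility on the reference play. -/
theorem play_eq_ref {G : MultiRoundSums N Ω Ξ} (hgrad : G.ZeroMessageGradient) {s : G.State}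
    {w : G.Profile} (hw : ∀ i, w i ∈ G.paramSet i) {ω : Ω}
    (h : (∀ t i, G.saving s w ω t i ∈ G.stateSet i) ∨ ∀ t i, G.refSaving s w ω t i ∈ G.stateSet i)
    (t : ℕ) : G.saving s w ω t = G.refSaving s w ω t ∧ G.action s w ω t = G.refAction s w ω t := by
  have hs : ∀ i, s.1 i ∈ G.stateSet i := by
    rcases h with h | h <;> exact h 0
  have hx : ∀ t, G.saving s w ω t = G.refSaving s w ω t →
      ∀ i, G.saving s w ω t i ∈ G.stateSet i := by
    intro t ht
    rcases h with h | h
    · exact h t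
    · exact ht ▸ h t
  have hact : ∀ t, G.saving s w ω t = G.refSaving s w ω t →
      G.SameNoise (G.traj s w ω t).2 (G.refMessages s ω t) →
      G.action s w ω t = G.refAction s w ω t := by
    intro t ht hm
    rw [refAction, ← ht]
    exact act_congr hgrad (hx t ht) hw hm
  have main : G.saving s w ω t = G.refSaving s w ω t ∧
      G.SameNoise (G.traj s w ω t).2 (G.refMessages s ω t) := by
    induction t with
    -- The initial messages are given and need not be values of the senders, hence the equality case
    -- in `SameNoise`.
    | zero => exact ⟨rfl, Or.inl rfl⟩
    | succ t ih =>
      have ha := hact t ih.1 ih.2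
      refine ⟨?_, Or.inr fun i => ?_⟩
      · funext i
        change G.saving s w ω t i - (G.action s w ω t i).1 =
          G.refSaving s w ω t i - (G.refAction s w ω t i).1
        rw [ha, ih.1]
      -- The reference datum is admissible because the initial saving is allowed; its action part is
      -- arbitrary.
      · exact ⟨G.noise i t ω, (G.saving s w ω t i, G.action s w ω t i), (s.1 i, 0, 0),
          hx t ih.1 i, hs i, rfl, rfl⟩
  exact ⟨main.1, hact t main.1 main.2⟩

theorem Feasible.saving_eq {G : MultiRoundSums N Ω Ξ} {s : G.State} {w : G.Profile}
    (h : G.Feasible s w) (hgrad : G.ZeroMessageGradient) (ω : Ω) (t : ℕ) :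
    G.saving s w ω t = G.refSaving s w ω t :=
  (play_eq_ref hgrad h.1 (Or.inl fun t i => (h.2 ω t i).1) t).1

theorem Feasible.action_eq {G : MultiRoundSums N Ω Ξ} {s : G.State} {w : G.Profile}
    (h : G.Feasible s w) (hgrad : G.ZeroMessageGradient) (ω : Ω) (t : ℕ) :
    G.action s w ω t = G.refAction s w ω t :=
  (play_eq_ref hgrad h.1 (Or.inl fun t i => (h.2 ω t i).1) t).2

/-- Feasibility can be tested on the play against reference messages. -/
theorem feasible_iff_ref {G : MultiRoundSums N Ω Ξ} (hgrad : G.ZeroMessageGradient) {s : G.State}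
    {w : G.Profile} : G.Feasible s w ↔ (∀ i, w i ∈ G.paramSet i) ∧
      ∀ ω t i, G.refSaving s w ω t i ∈ G.stateSet i ∧
        ∀ l, G.con i (G.refSaving s w ω t i) (G.refAction s w ω t i) l ≤ 0 := by
  constructor
  · intro h
    refine ⟨h.1, fun ω t i => ?_⟩
    rw [← h.saving_eq hgrad, ← h.action_eq hgrad]
    exact h.2 ω t i
  · intro h
    refine ⟨h.1, fun ω t i => ?_⟩
    have := play_eq_ref hgrad h.1 (Or.inr fun t i => (h.2 ω t i).1) t
    rw [this.1, this.2]
    exact h.2 ω t i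

/-- The feasible set is a product: feasible profiles can be mixed. -/
theorem feasible_of_components {G : MultiRoundSums N Ω Ξ} (hgrad : G.ZeroMessageGradient)
    {s : G.State} {w : G.Profile} (h : ∀ i, ∃ u, G.Feasible s u ∧ u i = w i) :
    G.Feasible s w := by
  rw [feasible_iff_ref hgrad]
  constructor
  · intro i
    obtain ⟨u, hu, hi⟩ := h i
    exact hi ▸ hu.1 i
  · intro ω t i
    obtain ⟨u, hu, hi⟩ := h i
    rw [G.refSaving_congr s hi.symm, G.refAction_congr s hi.symm]
    exact ((feasible_iff_ref hgrad).mp hu).2 ω t i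

/-! ### Separation of the values into one-agent returns. -/

/-- Discounted expected sum of the team term of agent `j` in the play against reference messages. -/
noncomputable def giveReturn (G : MultiRoundSums N Ω Ξ) (j : Fin N) (s : G.State) (w : G.Profile) : ℝ :=
  ∑' t : ℕ, G.γ ^ t * ∫ ω, G.giveTerm j (G.refAction s w ω t) ∂G.P

/-- Discounted expected sum of the individual term of agent `j` in the play against reference
messages. -/
noncomputable def ownReturn (G : MultiRoundSums N Ω Ξ) (j : Fin N) (s : G.State) (w : G.Profile) : ℝ :=
  ∑' t : ℕ, G.γ ^ t * ∫ ω, G.ownTerm j (G.refSaving s w ω t) (G.refAction s w ω t) ∂G.P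

theorem giveReturn_congr (G : MultiRoundSums N Ω Ξ) (s : G.State) {w w' : G.Profile} {j : Fin N}
    (h : w j = w' j) : G.giveReturn j s w = G.giveReturn j s w' := by
  simp only [giveReturn, giveTerm, G.refAction_congr s h]

theorem ownReturn_congr (G : MultiRoundSums N Ω Ξ) (s : G.State) {w w' : G.Profile} {j : Fin N}
    (h : w j = w' j) : G.ownReturn j s w = G.ownReturn j s w' := by
  simp only [ownReturn, ownTerm, G.refAction_congr s h, G.refSaving_congr s h]

/-- Absolute convergence in mean permits exchanging expectation and discounted series. -/
theorem summable_and_integral_discounted (G : MultiRoundSums N Ω Ξ) {f : ℕ → Ω → ℝ}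
    (hf : ∀ t, Integrable (f t) G.P) (hs : Summable fun t => G.γ ^ t * ∫ ω, |f t ω| ∂G.P) :
    Summable (fun t => G.γ ^ t * ∫ ω, f t ω ∂G.P) ∧
      ∫ ω, ∑' t, G.γ ^ t * f t ω ∂G.P = ∑' t, G.γ ^ t * ∫ ω, f t ω ∂G.P := by
  have hint : ∀ t, Integrable (fun ω => G.γ ^ t * f t ω) G.P := fun t => (hf t).const_mul _
  have hnorm : ∀ t, ∫ ω, ‖G.γ ^ t * f t ω‖ ∂G.P = G.γ ^ t * ∫ ω, |f t ω| ∂G.P := by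
    intro t
    simp_rw [norm_mul, Real.norm_eq_abs, abs_of_nonneg (pow_nonneg G.γ_nonneg t)]
    exact integral_const_mul _ _
  have hs' : Summable fun t => ∫ ω, ‖G.γ ^ t * f t ω‖ ∂G.P := by simpa only [hnorm] using hs
  have h := hasSum_integral_of_summable_integral_norm hint hs'
  simp_rw [integral_const_mul] at h
  exact ⟨h.summable, h.tsum_eq.symm⟩

/-- Absolutely convergent discounted expectations add up. -/
theorem integrable_summable_sum {ι : Type*} (G : MultiRoundSums N Ω Ξ) (S : Finset ι)
    {f : ι → ℕ → Ω → ℝ} (hf : ∀ i ∈ S, ∀ t, Integrable (f i t) G.P)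
    (hs : ∀ i ∈ S, Summable fun t => G.γ ^ t * ∫ ω, |f i t ω| ∂G.P) :
    (∀ t, Integrable (fun ω => ∑ i ∈ S, f i t ω) G.P) ∧
      Summable fun t => G.γ ^ t * ∫ ω, |∑ i ∈ S, f i t ω| ∂G.P := by
  have hi : ∀ t, Integrable (fun ω => ∑ i ∈ S, f i t ω) G.P :=
    fun t => integrable_finsetSum S fun i h => hf i h t
  refine ⟨hi, Summable.of_nonneg_of_le
    (fun t => mul_nonneg (pow_nonneg G.γ_nonneg t) (integral_nonneg fun ω => abs_nonneg _))
    (fun t => ?_) (summable_sum hs)⟩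
  rw [← Finset.mul_sum, ← integral_finsetSum S fun i h => (hf i h t).abs]
  exact mul_le_mul_of_nonneg_left (integral_mono (hi t).abs
    (integrable_finsetSum S fun i h => (hf i h t).abs)
    fun ω => Finset.abs_sum_le_sum_abs _ _) (pow_nonneg G.γ_nonneg t)

theorem tsum_discounted_sum {ι : Type*} (G : MultiRoundSums N Ω Ξ) (S : Finset ι)
    {f : ι → ℕ → Ω → ℝ} (hf : ∀ i ∈ S, ∀ t, Integrable (f i t) G.P)
    (hs : ∀ i ∈ S, Summable fun t => G.γ ^ t * ∫ ω, |f i t ω| ∂G.P) :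
    ∑' t, G.γ ^ t * ∫ ω, ∑ i ∈ S, f i t ω ∂G.P =
      ∑ i ∈ S, ∑' t, G.γ ^ t * ∫ ω, f i t ω ∂G.P := by
  rw [← Summable.tsum_finsetSum fun i h => (G.summable_and_integral_discounted (hf i h) (hs i h)).1]
  refine tsum_congr fun t => ?_
  rw [integral_finsetSum S fun i h => hf i h t, Finset.mul_sum]

/-- The team and individual terms of all agents, indexed by one type. -/
def term (G : MultiRoundSums N Ω Ξ) (s : G.State) (w : G.Profile) :
    Fin N ⊕ Fin N → ℕ → Ω → ℝ
  | .inl j => fun t ω => G.giveTerm j (G.action s w ω t)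
  | .inr j => fun t ω => G.ownTerm j (G.saving s w ω t) (G.action s w ω t)

theorem ReturnsConverge.integrable_term {G : MultiRoundSums N Ω Ξ} {s : G.State} {w : G.Profile}
    (h : G.ReturnsConverge s w) (i : Fin N ⊕ Fin N) (t : ℕ) :
    Integrable (G.term s w i t) G.P := by
  cases i with
  | inl j => exact (h j).1 t
  | inr j => exact (h j).2.1 t

theorem ReturnsConverge.summable_term {G : MultiRoundSums N Ω Ξ} {s : G.State} {w : G.Profile}
    (h : G.ReturnsConverge s w) (i : Fin N ⊕ Fin N) :
    Summable fun t => G.γ ^ t * ∫ ω, |G.term s w i t ω| ∂G.P := by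
  cases i with
  | inl j => exact (h j).2.2.1
  | inr j => exact (h j).2.2.2

theorem reward_eq_sum_term (G : MultiRoundSums N Ω Ξ) (k : Fin N) (s : G.State) (w : G.Profile)
    (ω : Ω) (t : ℕ) : G.reward k (G.saving s w ω t) (G.action s w ω t) =
      ∑ i ∈ Finset.univ.disjSum {k}, G.term s w i t ω := by
  simp [Finset.sum_disjSum, term, reward, giveTerm, ownTerm, add_assoc]

theorem J_eq_sum_term (G : MultiRoundSums N Ω Ξ) (s : G.State) (w : G.Profile)
    (ω : Ω) (t : ℕ) : G.J (G.saving s w ω t) (G.action s w ω t) =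
      ∑ i ∈ Finset.univ.disjSum Finset.univ, G.term s w i t ω := by
  simp [term, J, giveTerm, ownTerm, add_assoc, Finset.sum_add_distrib]

theorem reward_integrable_summable {G : MultiRoundSums N Ω Ξ} {s : G.State} {w : G.Profile}
    (h : G.ReturnsConverge s w) (k : Fin N) :
    (∀ t, Integrable (fun ω => G.reward k (G.saving s w ω t) (G.action s w ω t)) G.P) ∧
      Summable fun t => G.γ ^ t * ∫ ω, |G.reward k (G.saving s w ω t) (G.action s w ω t)| ∂G.P := by
  simp_rw [reward_eq_sum_term]
  exact G.integrable_summable_sum _ (fun i _ => h.integrable_term i) (fun i _ => h.summable_term i)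

theorem Feasible.tsum_term_inl {G : MultiRoundSums N Ω Ξ} (hgrad : G.ZeroMessageGradient)
    {s : G.State} {w : G.Profile} (h : G.Feasible s w) (j : Fin N) :
    ∑' t, G.γ ^ t * ∫ ω, G.term s w (.inl j) t ω ∂G.P = G.giveReturn j s w := by
  simp only [term, giveReturn, h.action_eq hgrad]

theorem Feasible.tsum_term_inr {G : MultiRoundSums N Ω Ξ} (hgrad : G.ZeroMessageGradient)
    {s : G.State} {w : G.Profile} (h : G.Feasible s w) (j : Fin N) :
    ∑' t, G.γ ^ t * ∫ ω, G.term s w (.inr j) t ω ∂G.P = G.ownReturn j s w := by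
  simp only [term, ownReturn, h.action_eq hgrad, h.saving_eq hgrad]

theorem value_eq_tsum {G : MultiRoundSums N Ω Ξ} {s : G.State} {w : G.Profile}
    (h : G.ReturnsConverge s w) (k : Fin N) : G.value k s w =
      ∑' t, G.γ ^ t * ∫ ω, G.reward k (G.saving s w ω t) (G.action s w ω t) ∂G.P :=
  (G.summable_and_integral_discounted (reward_integrable_summable h k).1 (reward_integrable_summable h k).2).2

/-- The separated form: by `giveReturn_congr` and `ownReturn_congr` every summand depends on the
parameter of a single agent. -/
theorem value_eq {G : MultiRoundSums N Ω Ξ} (hgrad : G.ZeroMessageGradient) {s : G.State}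
    {w : G.Profile} (hf : G.Feasible s w) (h : G.ReturnsConverge s w) (k : Fin N) :
    G.value k s w = ∑ j, G.giveReturn j s w + G.ownReturn k s w := by
  simp_rw [value_eq_tsum h, reward_eq_sum_term]
  rw [G.tsum_discounted_sum _ (fun i _ => h.integrable_term i) (fun i _ => h.summable_term i),
    Finset.sum_disjSum, Finset.sum_singleton]
  simp_rw [hf.tsum_term_inl hgrad, hf.tsum_term_inr hgrad]

theorem potentialValue_eq {G : MultiRoundSums N Ω Ξ} (hgrad : G.ZeroMessageGradient) {s : G.State}
    {w : G.Profile} (hf : G.Feasible s w) (h : G.ReturnsConverge s w) :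
    G.potentialValue s w = ∑ j, G.giveReturn j s w + ∑ j, G.ownReturn j s w := by
  have hsum := G.integrable_summable_sum (Finset.univ.disjSum Finset.univ)
    (fun i _ => h.integrable_term i) (fun i _ => h.summable_term i)
  have h1 := (G.summable_and_integral_discounted hsum.1 hsum.2).2
  rw [G.tsum_discounted_sum _ (fun i _ => h.integrable_term i) (fun i _ => h.summable_term i),
    Finset.sum_disjSum] at h1
  simp_rw [hf.tsum_term_inl hgrad, hf.tsum_term_inr hgrad] at h1
  simp_rw [potentialValue, expectedReturn, J_eq_sum_term]
  exact h1

/-! ### The potential property and the decomposition of the reward. -/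

theorem isMarkovPotential_potentialValue {G : MultiRoundSums N Ω Ξ}
    (hret : ∀ (s : G.State) (w : G.Profile), G.Feasible s w → G.ReturnsConverge s w)
    (hgrad : G.ZeroMessageGradient) : G.IsMarkovPotential G.potentialValue := by
  intro s i w w' hww hw hw'
  rw [potentialValue_eq hgrad hw (hret s w hw), potentialValue_eq hgrad hw' (hret s w' hw'),
    value_eq hgrad hw (hret s w hw), value_eq hgrad hw' (hret s w' hw')]
  -- Potential and value of agent `i` differ by the individual returns of the others, which a
  -- deviation of `i` leaves fixed.
  have : ∑ j ∈ Finset.univ.erase i, G.ownReturn j s w =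
      ∑ j ∈ Finset.univ.erase i, G.ownReturn j s w' :=
    Finset.sum_congr rfl fun j hj => G.ownReturn_congr s (hww j (Finset.ne_of_mem_erase hj))
  rw [← Finset.add_sum_erase _ (fun j => G.ownReturn j s w) (Finset.mem_univ i),
    ← Finset.add_sum_erase _ (fun j => G.ownReturn j s w') (Finset.mem_univ i), this]
  ring

theorem rewardDecomposition {G : MultiRoundSums N Ω Ξ} (hgrad : G.ZeroMessageGradient) :
    G.RewardDecomposition := by
  intro k
  refine ⟨fun x a => ?_, fun x x' a a' h => ?_, fun x hx w hw m ξ y hy => ?_⟩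
  · have h := Finset.add_sum_erase Finset.univ (fun j => G.α * x j + G.β * (a j).2)
      (Finset.mem_univ k)
    have hJ : G.J x a = ∑ j, (1 - (a j).2) * (a j).1 + ∑ j, (G.α * x j + G.β * (a j).2) := by
      rw [J, ← Finset.sum_add_distrib]
      exact Finset.sum_congr rfl fun j _ => add_assoc _ _ _
    rw [hJ, reward, Θ, ← h]
    ring
  · rw [Θ, Θ, neg_inj]
    refine Finset.sum_congr rfl fun j hj => ?_
    rw [(h j (Finset.ne_of_mem_erase hj)).1, (h j (Finset.ne_of_mem_erase hj)).2]
  -- For `j ≠ k` the saving and parameter of `j` are held fixed, so the data of `k` enter only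
  -- through the message that `j` receives.
  · have hterm : ∀ j ∈ Finset.univ.erase k, HasFDerivWithinAt
        (fun y : ℝ × ℝ × ℝ => G.α * Function.update x k y.1 j +
          G.β * (G.act (Function.update x k y.1) (Function.update m k (G.sender k y ξ)) w j).2)
        (0 : ℝ × ℝ × ℝ →L[ℝ] ℝ) (G.stateSet k ×ˢ univ) y := by
      intro j hj
      have hjk := Finset.ne_of_mem_erase hj
      have h := hgrad k j hjk.symm (x j) (hx j) (w j) (hw j) m ξ y hy
      have h2 := ((h.snd).const_mul G.β).const_add (G.α * x j)
      simp only [act, Function.update_of_ne hjk]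
      refine h2.congr_fderiv ?_
      ext <;> simp
    refine (HasFDerivWithinAt.fun_sum hterm).fun_neg.congr_fderiv ?_
    simp

/-! ### Closedness, semicontinuity and existence of maximizers. -/

/-- Limits of feasible profiles are feasible, and the rewards in each round converge. -/
theorem feasible_of_tendsto {G : MultiRoundSums N Ω Ξ} (hgrad : G.ZeroMessageGradient)
    (hconv : G.ConvexSets) (hsm : G.SmoothRewards) (hreg : G.RegularConstraints) {s : G.State}
    {u : ℕ → G.Profile} (hu : ∀ n, G.Feasible s (u n)) {w : G.Profile}
    (hlim : Tendsto u atTop (𝓝 w)) :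
    G.Feasible s w ∧ ∀ (k : Fin N) (ω : Ω) (t : ℕ),
      Tendsto (fun n => G.reward k (G.saving s (u n) ω t) (G.action s (u n) ω t)) atTop
        (𝓝 (G.reward k (G.saving s w ω t) (G.action s w ω t))) := by
  have hu' := fun n => (feasible_iff_ref hgrad).mp (hu n)
  have hw : ∀ i, w i ∈ G.paramSet i := fun i =>
    (hconv i).2.2.1.mem_of_tendsto (hlim.apply_nhds i) (Eventually.of_forall fun n => (hu n).1 i)
  have hmemZ : ∀ ω t, Tendsto (fun n => G.refSaving s (u n) ω t) atTop (𝓝 (G.refSaving s w ω t)) →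
      ∀ i, G.refSaving s w ω t i ∈ G.stateSet i := fun ω t h i =>
    (hconv i).1.2.1.mem_of_tendsto (h.apply_nhds i)
      (Eventually.of_forall fun n => ((hu' n).2 ω t i).1)
  have hwithin : ∀ ω t,
      Tendsto (fun n => G.refSaving s (u n) ω t) atTop (𝓝 (G.refSaving s w ω t)) →
      Tendsto (fun n => (G.refSaving s (u n) ω t, u n)) atTop
        (𝓝[G.domain] (G.refSaving s w ω t, w)) := fun ω t h =>
    tendsto_nhdsWithin_iff.mpr ⟨h.prodMk_nhds hlim,
      Eventually.of_forall fun n => ⟨fun i => ((hu' n).2 ω t i).1, (hu n).1⟩⟩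
  -- For fixed noise the reference messages do not depend on the profile, so continuity of the
  -- transition at fixed messages is enough and no regularity of the senders enters.
  have hx : ∀ ω t,
      Tendsto (fun n => G.refSaving s (u n) ω t) atTop (𝓝 (G.refSaving s w ω t)) := by
    intro ω t
    induction t with
    | zero => exact tendsto_const_nhds
    | succ t ih =>
      have hc := (hreg.1 (G.refMessages s ω t)).continuousOn
      exact (hc (G.refSaving s w ω t, w) ⟨hmemZ ω t ih, hw⟩).tendsto.comp (hwithin ω t ih)
  have hfeas : G.Feasible s w := by
    rw [feasible_iff_ref hgrad]
    refine ⟨hw, fun ω t i => ⟨hmemZ ω t (hx ω t) i, fun l => ?_⟩⟩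
    have hc := (hreg.2.1 (G.refMessages s ω t) i l).continuousOn
    have hcl := (hc (G.refSaving s w ω t, w) ⟨hmemZ ω t (hx ω t), hw⟩).tendsto.comp
      (hwithin ω t (hx ω t))
    exact le_of_tendsto hcl (Eventually.of_forall fun n => ((hu' n).2 ω t i).2 l)
  refine ⟨hfeas, fun k ω t => ?_⟩
  simp only [fun n => (hu n).saving_eq hgrad, fun n => (hu n).action_eq hgrad,
    hfeas.saving_eq hgrad, hfeas.action_eq hgrad, refAction]
  have hc := (hsm (G.refMessages s ω t) k).continuousOn
  have hck := (hc (G.refSaving s w ω t, w) ⟨hmemZ ω t (hx ω t), hw⟩).tendsto.comp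
    (hwithin ω t (hx ω t))
  simpa only [Function.comp_def] using hck

/-- Discounted expected shortfall of the rewards below a bound `C`. -/
theorem ofReal_shortfall {G : MultiRoundSums N Ω Ξ} {s : G.State} {w : G.Profile} {k : Fin N}
    (hr : G.ReturnsConverge s w) {C : ℝ}
    (hC : ∀ ω t, G.reward k (G.saving s w ω t) (G.action s w ω t) ≤ C) :
    0 ≤ C * (1 - G.γ)⁻¹ - G.value k s w ∧
    ENNReal.ofReal (C * (1 - G.γ)⁻¹ - G.value k s w) = ∑' t, ∫⁻ ω, ENNReal.ofReal
      (G.γ ^ t * (C - G.reward k (G.saving s w ω t) (G.action s w ω t))) ∂G.P := by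
  have := G.isProbabilityMeasure_P
  have hi := (reward_integrable_summable hr k).1
  have hs := (G.summable_and_integral_discounted hi (reward_integrable_summable hr k).2).1
  -- `C * (1 - γ)⁻¹` is the value of the constant reward `C`.
  have hg : HasSum (fun t => C * G.γ ^ t) (C * (1 - G.γ)⁻¹) :=
    (hasSum_geometric_of_lt_one G.γ_nonneg G.γ_lt_one).mul_left C
  have hint : ∀ t, Integrable (fun ω =>
      G.γ ^ t * (C - G.reward k (G.saving s w ω t) (G.action s w ω t))) G.P :=
    fun t => ((integrable_const C).sub (hi t)).const_mul _
  have hnn : ∀ t ω, 0 ≤ G.γ ^ t * (C - G.reward k (G.saving s w ω t) (G.action s w ω t)) :=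
    fun t ω => mul_nonneg (pow_nonneg G.γ_nonneg t) (sub_nonneg.mpr (hC ω t))
  have hval : HasSum (fun t => ∫ ω,
      G.γ ^ t * (C - G.reward k (G.saving s w ω t) (G.action s w ω t)) ∂G.P)
      (C * (1 - G.γ)⁻¹ - G.value k s w) := by
    rw [value_eq_tsum hr]
    refine (hg.sub hs.hasSum).congr_fun fun t => ?_
    rw [integral_const_mul, integral_sub (integrable_const C) (hi t)]
    simp
    ring
  refine ⟨hval.nonneg fun t => integral_nonneg (hnn t), ?_⟩
  rw [← hval.tsum_eq, ENNReal.ofReal_tsum_of_nonneg (fun t => integral_nonneg (hnn t))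
    hval.summable]
  exact tsum_congr fun t => ofReal_integral_eq_lintegral_ofReal (hint t)
    (Eventually.of_forall (hnn t))

/-- The value is upper semicontinuous along feasible profiles with bounded rewards. -/
theorem le_value_of_tendsto {G : MultiRoundSums N Ω Ξ}
    (hret : ∀ (s : G.State) (w : G.Profile), G.Feasible s w → G.ReturnsConverge s w)
    {s : G.State} {k : Fin N} {C : ℝ}
    (hC : ∀ w, G.Feasible s w → ∀ ω t, G.reward k (G.saving s w ω t) (G.action s w ω t) ≤ C)
    {u : ℕ → G.Profile} (hu : ∀ n, G.Feasible s (u n)) {w : G.Profile} (hw : G.Feasible s w)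
    (hlim : ∀ ω t, Tendsto (fun n => G.reward k (G.saving s (u n) ω t) (G.action s (u n) ω t))
      atTop (𝓝 (G.reward k (G.saving s w ω t) (G.action s w ω t))))
    {L : ℝ} (hL : Tendsto (fun n => G.value k s (u n)) atTop (𝓝 L)) : L ≤ G.value k s w := by
  have := G.isProbabilityMeasure_P
  have hshort := fun n => ofReal_shortfall (hret s (u n) (hu n)) (hC (u n) (hu n))
  have hlimL : Tendsto (fun n => C * (1 - G.γ)⁻¹ - G.value k s (u n)) atTop
      (𝓝 (C * (1 - G.γ)⁻¹ - L)) := tendsto_const_nhds.sub hL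
  have hL0 : 0 ≤ C * (1 - G.γ)⁻¹ - L :=
    ge_of_tendsto hlimL (Eventually.of_forall fun n => (hshort n).1)
  have hmeas : ∀ v, G.Feasible s v → ∀ t, AEMeasurable (fun ω => ENNReal.ofReal
      (G.γ ^ t * (C - G.reward k (G.saving s v ω t) (G.action s v ω t)))) G.P := fun v hv t =>
    (((integrable_const C).sub ((reward_integrable_summable (hret s v hv) k).1 t)).const_mul
      _).aestronglyMeasurable.aemeasurable.ennreal_ofReal
  have hle : ENNReal.ofReal (C * (1 - G.γ)⁻¹ - G.value k s w) ≤
      ENNReal.ofReal (C * (1 - G.γ)⁻¹ - L) := by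
    rw [(ofReal_shortfall (hret s w hw) (hC w hw)).2]
    -- Fatou's lemma is applied to the nonnegative shortfalls `C - r`. Truncating at `T` makes
    -- pointwise convergence pass through a finite sum; on the side of `u n` the truncated sum is at
    -- most the full series.
    refine ENNReal.tsum_le_of_sum_range_le fun T => ?_
    rw [← lintegral_finsetSum' _ fun t _ => hmeas w hw t]
    calc _ = ∫⁻ ω, liminf (fun n => ∑ t ∈ Finset.range T, ENNReal.ofReal (G.γ ^ t *
          (C - G.reward k (G.saving s (u n) ω t) (G.action s (u n) ω t)))) atTop ∂G.P := by
          refine lintegral_congr fun ω => (Tendsto.liminf_eq ?_).symm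
          exact tendsto_finsetSum _ fun t _ =>
            ENNReal.tendsto_ofReal ((tendsto_const_nhds.sub (hlim ω t)).const_mul _)
      _ ≤ liminf (fun n => ∫⁻ ω, ∑ t ∈ Finset.range T, ENNReal.ofReal (G.γ ^ t *
          (C - G.reward k (G.saving s (u n) ω t) (G.action s (u n) ω t))) ∂G.P) atTop :=
          lintegral_liminf_le' fun n => Finset.aemeasurable_fun_sum _ fun t _ => hmeas _ (hu n) t
      _ ≤ liminf (fun n => ENNReal.ofReal (C * (1 - G.γ)⁻¹ - G.value k s (u n))) atTop := by
          refine liminf_le_liminf (Eventually.of_forall fun n => ?_)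
          rw [(hshort n).2, lintegral_finsetSum' _ fun t _ => hmeas _ (hu n) t]
          exact ENNReal.sum_le_tsum _
      _ = _ := (ENNReal.tendsto_ofReal hlimL).liminf_eq
  linarith [(ENNReal.ofReal_le_ofReal_iff hL0).mp hle]

/-- Values inherit an upper bound on the rewards. -/
theorem value_le_of_reward_le {G : MultiRoundSums N Ω Ξ} {s : G.State} {w : G.Profile} {k : Fin N}
    (hr : G.ReturnsConverge s w) {C : ℝ}
    (hC : ∀ ω t, G.reward k (G.saving s w ω t) (G.action s w ω t) ≤ C) :
    G.value k s w ≤ C * (1 - G.γ)⁻¹ :=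
  sub_nonneg.mp (ofReal_shortfall hr hC).1

/-- Values inherit a lower bound on the rewards. -/
theorem le_value_of_le_reward {G : MultiRoundSums N Ω Ξ} {s : G.State} {w : G.Profile} {k : Fin N}
    (hr : G.ReturnsConverge s w) {C : ℝ}
    (hC : ∀ ω t, C ≤ G.reward k (G.saving s w ω t) (G.action s w ω t)) :
    C * (1 - G.γ)⁻¹ ≤ G.value k s w := by
  have := G.isProbabilityMeasure_P
  have hi := (reward_integrable_summable hr k).1
  have hs := (G.summable_and_integral_discounted hi (reward_integrable_summable hr k).2).1
  rw [value_eq_tsum hr, mul_comm]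
  refine hasSum_le (fun t => ?_)
    ((hasSum_geometric_of_lt_one G.γ_nonneg G.γ_lt_one).mul_right C) hs.hasSum
  refine mul_le_mul_of_nonneg_left ?_ (pow_nonneg G.γ_nonneg t)
  simpa using integral_mono (integrable_const C) (hi t) (hC · t)

/-- Each agent's value attains its maximum over all feasible profiles. -/
theorem exists_isMaxOn_value {G : MultiRoundSums N Ω Ξ}
    (hret : ∀ (s : G.State) (w : G.Profile), G.Feasible s w → G.ReturnsConverge s w)
    (hgrad : G.ZeroMessageGradient) (hconv : G.ConvexSets) (hsm : G.SmoothRewards)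
    (hreg : G.RegularConstraints) {s : G.State} (hlev : G.BoundedLevelSets s) (k : Fin N) :
    ∃ w, G.Feasible s w ∧ ∀ v, G.Feasible s v → G.value k s v ≤ G.value k s w := by
  have := G.isProbabilityMeasure_P
  have : Nonempty Ω := nonempty_of_isProbabilityMeasure G.P
  obtain ⟨B, hB⟩ := hlev
  obtain ⟨⟨w₀, hw₀⟩, hbdd⟩ := hB k
  have hw₀f : G.Feasible s w₀ := (hw₀ (Classical.arbitrary Ω) 0).1
  obtain ⟨R, hR⟩ := hbdd.exists_norm_le
  -- A single reward of at least `B`, in any round and outcome, already bounds the profile by `R`.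
  have hmem : ∀ w, G.Feasible s w → ∀ ω t,
      B ≤ G.reward k (G.saving s w ω t) (G.action s w ω t) →
      ‖w‖ ≤ R ∧ ‖(G.saving s w ω t, G.action s w ω t)‖ ≤ R := by
    intro w hw ω t h
    exact norm_prod_le_iff.mp (hR (w, G.saving s w ω t, G.action s w ω t)
      (mem_iUnion.mpr ⟨t, hw, ⟨ω, rfl⟩, h⟩))
  obtain ⟨C, hC⟩ : ∃ C, ∀ w, G.Feasible s w → ∀ ω t,
      G.reward k (G.saving s w ω t) (G.action s w ω t) ≤ C := by
    have hcont : Continuous fun z : (Fin N → ℝ) × Action N => G.reward k z.1 z.2 := by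
      unfold reward
      fun_prop
    obtain ⟨C, hC⟩ := (isCompact_closedBall (0 : (Fin N → ℝ) × Action N)
      R).exists_bound_of_continuousOn hcont.continuousOn
    -- A reward is either below `B` or attained in the ball of radius `R`, where this continuous
    -- function is bounded by `C`.
    refine ⟨max B C, fun w hw ω t => ?_⟩
    rcases le_total B (G.reward k (G.saving s w ω t) (G.action s w ω t)) with h | h
    · have hz := hC (G.saving s w ω t, G.action s w ω t)
        (mem_closedBall_zero_iff.mpr (hmem w hw ω t h).2)
      exact le_max_of_le_right ((le_abs_self _).trans hz)
    · exact le_max_of_le_left h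
  let K : Set G.Profile := {w | G.Feasible s w} ∩ Metric.closedBall 0 R
  have hclosed : IsClosed {w | G.Feasible s w} :=
    IsSeqClosed.isClosed fun u w hu hlim =>
      (feasible_of_tendsto hgrad hconv hsm hreg hu hlim).1
  have hK : IsCompact K := (isCompact_closedBall _ _).inter_left hclosed
  have hw₀K : w₀ ∈ K := ⟨hw₀f, mem_closedBall_zero_iff.mpr
    (hmem w₀ hw₀f (Classical.arbitrary Ω) 0 (hw₀ (Classical.arbitrary Ω) 0).2.2).1⟩
  have hbound : BddAbove (G.value k s '' K) := by
    refine ⟨C * (1 - G.γ)⁻¹, ?_⟩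
    rintro _ ⟨w, hw, rfl⟩
    exact value_le_of_reward_le (hret s w hw.1) (hC w hw.1)
  obtain ⟨a, -, hlima, ha⟩ := exists_seq_tendsto_sSup ⟨_, mem_image_of_mem _ hw₀K⟩ hbound
  choose u huK hua using ha
  obtain ⟨w, hwK, φ, hφ, hlim⟩ := hK.tendsto_subseq huK
  have hlimw := feasible_of_tendsto hgrad hconv hsm hreg (fun n => (huK (φ n)).1) hlim
  have hsup : sSup (G.value k s '' K) ≤ G.value k s w :=
    le_value_of_tendsto hret hC (fun n => (huK (φ n)).1) hlimw.1 (hlimw.2 k)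
      ((hlima.comp hφ.tendsto_atTop).congr fun n => (hua (φ n)).symm)
  have hmaxK : ∀ v ∈ K, G.value k s v ≤ G.value k s w := fun v hv =>
    (le_csSup hbound (mem_image_of_mem _ hv)).trans hsup
  refine ⟨w, hwK.1, fun v hv => ?_⟩
  by_cases hvR : ‖v‖ ≤ R
  · exact hmaxK v ⟨hv, mem_closedBall_zero_iff.mpr hvR⟩
  -- Outside the ball all rewards are at most `B`, while `w₀` earns at least `B` in every round, so
  -- such profiles cannot beat `w₀`.
  · calc G.value k s v ≤ B * (1 - G.γ)⁻¹ := value_le_of_reward_le (hret s v hv) fun ω t =>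
          le_of_not_ge fun h => hvR (hmem v hv ω t h).1
      _ ≤ G.value k s w₀ := le_value_of_le_reward (hret s w₀ hw₀f) fun ω t => (hw₀ ω t).2.2
      _ ≤ _ := hmaxK w₀ hw₀K

/-! ### Assembling the equilibrium. -/

/-- Profiles made of each agent's component of a maximizer of its own value are equilibria. -/
theorem exists_isNash {G : MultiRoundSums N Ω Ξ}
    (hret : ∀ (s : G.State) (w : G.Profile), G.Feasible s w → G.ReturnsConverge s w)
    (hgrad : G.ZeroMessageGradient) {s : G.State}
    (hmax : ∀ k, ∃ w, G.Feasible s w ∧ ∀ v, G.Feasible s v → G.value k s v ≤ G.value k s w) :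
    ∃ w : G.Profile, G.IsNash s w := by
  choose u hu humax using hmax
  let w : G.Profile := fun k => u k k
  have hw : G.Feasible s w := feasible_of_components hgrad fun i => ⟨u i, hu i, rfl⟩
  -- The last sum does not involve the parameter of `i`, so it cancels in every comparison of
  -- deviations of `i`.
  have hsplit : ∀ (i : Fin N) (v : G.Profile), G.Feasible s v →
      G.value i s v = G.giveReturn i s v + G.ownReturn i s v +
        ∑ j ∈ Finset.univ.erase i, G.giveReturn j s v := by
    intro i v hv
    rw [value_eq hgrad hv (hret s v hv), ← Finset.add_sum_erase _ _ (Finset.mem_univ i)]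
    ring
  refine ⟨w, hw, fun i v hv => ?_⟩
  -- The deviation `v` is moved from `w` to the maximizer `u i`, where optimality applies; the gain
  -- is the same at both, and feasibility is kept by the product structure.
  have hfeas : G.Feasible s (Function.update (u i) i v) := by
    refine feasible_of_components hgrad fun j => ?_
    by_cases hj : j = i
    · subst hj
      exact ⟨_, hv, by simp⟩
    · exact ⟨u i, hu i, by simp [hj]⟩
  have hle := humax i _ hfeas
  have hv_i : Function.update (u i) i v i = Function.update w i v i := by simp
  have hrest : ∀ a : G.Profile, ∑ j ∈ Finset.univ.erase i, G.giveReturn j s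
      (Function.update a i v) = ∑ j ∈ Finset.univ.erase i, G.giveReturn j s a := fun a =>
    Finset.sum_congr rfl fun j hj => G.giveReturn_congr s
      (Function.update_of_ne (Finset.ne_of_mem_erase hj) _ _)
  rw [hsplit i _ hfeas, hsplit i _ (hu i), hrest, G.giveReturn_congr s hv_i,
    G.ownReturn_congr s hv_i] at hle
  rw [hsplit i _ hv, hsplit i _ hw, hrest,
    G.giveReturn_congr s (show w i = u i i from rfl),
    G.ownReturn_congr s (show w i = u i i from rfl)]
  linarith

end MultiRoundSums

theorem theorem3 {N : ℕ} {Ω Ξ : Type*} [MeasurableSpace Ω] [MeasurableSpace Ξ]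
    (G : MultiRoundSums N Ω Ξ)
    (hret : ∀ (s : G.State) (w : G.Profile), G.Feasible s w → G.ReturnsConverge s w)
    (hgrad : G.ZeroMessageGradient) :
    G.RewardDecomposition ∧
    G.IsMarkovPotentialGame ∧
    G.IsMarkovPotential G.potentialValue ∧
    (G.ConvexSets → G.SmoothRewards → G.RegularConstraints →
      ∀ s : G.State, G.BoundedLevelSets s → ∃ w : G.Profile, G.IsNash s w) := by
  have hpot := MultiRoundSums.isMarkovPotential_potentialValue hret hgrad
  exact ⟨MultiRoundSums.rewardDecomposition hgrad, ⟨_, hpot⟩, hpot,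
    fun hconv hsm hreg _ hlev => MultiRoundSums.exists_isNash hret hgrad
      (MultiRoundSums.exists_isMaxOn_value hret hgrad hconv hsm hreg hlev)⟩
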